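/- Let $D \subset \mathbb{R}^d$ be a bounded domain (open, connected, nonempty) with closure $\overline D$, let $\lambda : \overline{D} \to (0,\infty)$ be continuous, and put $\overline\lambda := \int_{\overline D} \lambda(x)\,dx$. Let $\mathcal{S}(\overline D)$ be the space of lower semicontinuous functions $f:\overline D \to \mathbb{R}\cup\{+\infty\}$, equipped with the topology $\sigma$ of $\Gamma$-convergence, i.e. the topology generated by the sets $\{f : \inf_U f < t\}$ with $U \subset \overline D$ relatively open and $t\in\mathbb{R}$, together with the sets $\{f : \inf_K f > t\}$ with $K \subset \overline D$ compact and $t \in \mathbb{R}$ (where $\inf_\emptyset f = +\infty$), and with its Borel $\sigma$-algebra. Write $\mathcal{P}(\mathcal{S}(\overline D))$ for the Borel probability measures on $\mathcal{S}(\overline D)$ with the topology of weak convergence. A random element $W_\lambda$ of $\mathcal{S}(\overline D)$ is called an extreme value process with rate $\lambda$ if 1. for every closed set $C\subset\mathbb{R}^d$, the random variable $\min_{x\in C\cap \overline D} W_\lambda(x)$ is exponentially distributed with rate $\lambda_C := \int_{C\cap\overline D}\lambda(x)\,dx$ (a variable that is exponential with rate $0$ is almost surely equal to $+\infty$, and the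 minimum over the empty set is $+\infty$); 2. for every finite collection of pairwise disjoint closed sets $C_1,\dots,C_k \subset \mathbb{R}^d$, the random variables $\min_{C_1\cap\overline D}W_\lambda,\dots,\min_{C_k\cap\overline D}W_\lambda$ are independent. **Proposition.** An extreme value process $W_\lambda$ with rate $\lambda$ exists. Moreover, let $x_1,x_2,\dots$ be points of $\overline D$ such that the empirical measures $\mu_n := \frac1n\sum_{i=1}^n\delta_{x_i}$ converge weakly to the probability measure on $\overline D$ with density $\lambda/\overline\lambda$, and let $\xi_1,\xi_2,\dots$ be i.i.d. exponential random variables with rate one. Then the random functions $$W_n(x) := \min\Big\{\tfrac{n}{\overline\lambda}\,\xi_i \;:\; 1\le i\le n,\ x_i = x\Big\},\qquad x \in \overline D,\quad \min\emptyset := +\infty$$ (so that, for distinct points, $W_n(x_i) = \frac{n}{\overline\lambda}\xi_i$ for $1\le i\le n$ and $W_n=+\infty$ elsewhere) are random elements of $\mathcal{S}(\overline D)$, and for every extreme value process $W_\lambda$ with rate $\lambda$ the law of $W_n$ converges weakly in $\mathcal{P}(\mathcal{S}(\overline D))$ to the law of $W_\lambda$ as $n\to\infty$. -/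

import Mathlib

open MeasureTheory ProbabilityTheory Filter Topology
open scoped NNReal ENNReal

/-! ### Lower semicontinuous functions and the topology of Gamma-convergence -/

/-- The space `S(X)` of lower semicontinuous functions on `X` with values in `ℝ ∪ {+∞}`,
realised as the lower semicontinuous `EReal`-valued functions that avoid `-∞`. -/
structure LscFun (X : Type*) [TopologicalSpace X] where
  toFun : X → EReal
  lowerSemicontinuous : LowerSemicontinuous toFun
  ne_bot : ∀ x, toFun x ≠ ⊥

namespace LscFun

/-- The infimum of `f` over `A`; it is `+∞` if `A` is empty. (If `A` is compact and nonempty, it is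
attained, so that it is the minimum of `f` over `A`.) -/
noncomputable def infOn {X : Type*} [TopologicalSpace X] (f : LscFun X) (A : Set X) : EReal :=
  ⨅ x ∈ A, f.toFun x

/-- The topology generated by the sets `{f | inf_U f < t}`, `U` open and `t` real. -/
abbrev sigmaPlus (X : Type*) [TopologicalSpace X] : TopologicalSpace (LscFun X) :=
  TopologicalSpace.generateFrom
    {S | ∃ (U : Set X) (t : ℝ), IsOpen U ∧ S = {f : LscFun X | f.infOn U < (t : EReal)}}

/-- The topology generated by the sets `{f | inf_K f > t}`, `K` compact and `t` real. -/
abbrev sigmaMinus (X : Type*) [TopologicalSpace X] : TopologicalSpace (LscFun X) :=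
  TopologicalSpace.generateFrom
    {S | ∃ (K : Set X) (t : ℝ), IsCompact K ∧ S = {f : LscFun X | (t : EReal) < f.infOn K}}

/-- The topology `σ` of Gamma-convergence: the smallest topology whose open sets include those of
`sigmaPlus` and of `sigmaMinus` (Mathlib orders topologies so that this is the infimum). -/
instance {X : Type*} [TopologicalSpace X] : TopologicalSpace (LscFun X) :=
  sigmaPlus X ⊓ sigmaMinus X

instance {X : Type*} [TopologicalSpace X] : MeasurableSpace (LscFun X) :=
  borel (LscFun X)

instance {X : Type*} [TopologicalSpace X] : BorelSpace (LscFun X) := ⟨rfl⟩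

/-- The function equal to `v i` at `x i` for `i < n` and to `+∞` elsewhere. If a point occurs
several times among the `x i`, `i < n`, the smallest of the corresponding values is taken. -/
noncomputable def ofPoints {X : Type*} [TopologicalSpace X] [T1Space X]
    (n : ℕ) (x : ℕ → X) (v : ℕ → ℝ) : LscFun X where
  toFun y := ⨅ i : ℕ, ⨅ _ : i < n ∧ x i = y, (v i : EReal)
  lowerSemicontinuous := by
    intro y b hb
    have hfin : ((fun i => x i) '' (Finset.range n : Set ℕ) \ {y}).Finite :=
      ((Finset.range n).finite_toSet.image _).sdiff
    have hmem : ((fun i => x i) '' (Finset.range n : Set ℕ) \ {y})ᶜ ∈ 𝓝 y :=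
      hfin.isClosed.isOpen_compl.mem_nhds (by simp)
    filter_upwards [hmem] with z hz
    by_cases hzy : z = y
    · rw [hzy]; exact hb
    · have hz' : ∀ i, ¬ (i < n ∧ x i = z) := by
        rintro i ⟨hi, rfl⟩
        exact hz ⟨⟨i, by simpa using hi, rfl⟩, hzy⟩
      have : (⨅ i : ℕ, ⨅ _ : i < n ∧ x i = z, (v i : EReal)) = ⊤ := by
        simp [hz']
      rw [this]
      exact lt_of_lt_of_le hb le_top
  ne_bot := by
    intro y h
    have hlow : ∃ m : ℝ, ∀ i < n, m ≤ v i := by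
      obtain ⟨m, hm⟩ := ((Finset.range n).finite_toSet.image v).bddBelow
      exact ⟨m, fun i hi => hm ⟨i, by simpa using hi, rfl⟩⟩
    obtain ⟨m, hm⟩ := hlow
    have : (m : EReal) ≤ ⨅ i : ℕ, ⨅ _ : i < n ∧ x i = y, (v i : EReal) :=
      le_iInf fun i => le_iInf fun hi => EReal.coe_le_coe_iff.2 (hm i hi.1)
    rw [h] at this
    exact EReal.coe_ne_bot m (le_bot_iff.1 this)

theorem ofPoints_apply_of_injective {X : Type*} [TopologicalSpace X] [T1Space X] {n : ℕ}
    {x : ℕ → X} (hx : Function.Injective x) (v : ℕ → ℝ) {i : ℕ} (hi : i < n) :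
    (ofPoints n x v).toFun (x i) = (v i : EReal) := by
  apply le_antisymm
  · exact iInf₂_le i ⟨hi, rfl⟩
  · exact le_iInf fun j => le_iInf fun hj => by rw [hx hj.2]

theorem ofPoints_apply_of_forall_ne {X : Type*} [TopologicalSpace X] [T1Space X] {n : ℕ}
    {x : ℕ → X} (v : ℕ → ℝ) {y : X} (hy : ∀ i < n, x i ≠ y) :
    (ofPoints n x v).toFun y = ⊤ :=
  iInf_eq_top.2 fun i => iInf_eq_top.2 fun h => absurd h.2 (hy i h.1)

end LscFun

/-! ### The process `W_λ` -/

/-- The exponential distribution with rate `r ≥ 0` on the extended line; a variable which is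
exponential with rate `0` equals `+∞` almost surely. -/
noncomputable def extExpMeasure (r : ℝ) : Measure EReal :=
  if r = 0 then Measure.dirac ⊤ else (expMeasure r).map Real.toEReal

/-- The minimum of `f ∈ S(closure D)` over `C ∩ closure D`. -/
noncomputable def minOver {d : ℕ} {D : Set (EuclideanSpace ℝ (Fin d))}
    (C : Set (EuclideanSpace ℝ (Fin d))) (f : LscFun (closure D)) : EReal :=
  f.infOn {y : closure D | (y : EuclideanSpace ℝ (Fin d)) ∈ C}

/-- `W` is a random element of `S(closure D)`, on the probability space `(Ω, P)`, with the defining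
properties of `W_λ`: the minimum over `C ∩ closure D`, `C` closed, is exponential with rate
`∫_{C ∩ closure D} λ`, and the minima over finitely many disjoint closed sets are independent. -/
structure IsExtremeValueProcess {d : ℕ} {D : Set (EuclideanSpace ℝ (Fin d))}
    (lam : EuclideanSpace ℝ (Fin d) → ℝ) {Ω : Type*} [MeasurableSpace Ω]
    (W : Ω → LscFun (closure D)) (P : Measure Ω) : Prop where
  aemeasurable : AEMeasurable W P
  hasLaw_min : ∀ C : Set (EuclideanSpace ℝ (Fin d)), IsClosed C →
    HasLaw (fun ω => minOver C (W ω)) (extExpMeasure (∫ y in C ∩ closure D, lam y)) P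
  iIndepFun_min : ∀ (k : ℕ) (C : Fin k → Set (EuclideanSpace ℝ (Fin d))),
    (∀ i, IsClosed (C i)) → Pairwise (fun i j => Disjoint (C i) (C j)) →
    iIndepFun (fun i ω => minOver (C i) (W ω)) P

/-! ### Empirical measures and their limit -/

/-- The empirical measure `(1/n) ∑_{i < n} δ_{x i}` (which is `0` for `n = 0`). -/
noncomputable def empiricalMeasure {E : Type*} [MeasurableSpace E] (x : ℕ → E) (n : ℕ) :
    FiniteMeasure E :=
  (n : ℝ≥0)⁻¹ • ∑ i ∈ Finset.range n, (diracProba (x i)).toFiniteMeasure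

/-- The total mass `∫_{closure D} λ`. -/
noncomputable def totalRate {d : ℕ} (D : Set (EuclideanSpace ℝ (Fin d)))
    (lam : EuclideanSpace ℝ (Fin d) → ℝ) : ℝ :=
  ∫ y in closure D, lam y

theorem totalRate_pos {d : ℕ} {D : Set (EuclideanSpace ℝ (Fin d))}
    {lam : EuclideanSpace ℝ (Fin d) → ℝ} (hDo : IsOpen D) (hDn : D.Nonempty)
    (hDb : Bornology.IsBounded D) (hlam : ContinuousOn lam (closure D))
    (hpos : ∀ y ∈ closure D, 0 < lam y) : 0 < totalRate D lam := by
  have hint : IntegrableOn lam (closure D) :=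
    hlam.integrableOn_compact hDb.isCompact_closure
  have hnn : 0 ≤ᵐ[volume.restrict (closure D)] lam :=
    (ae_restrict_mem isClosed_closure.measurableSet).mono fun y hy => (hpos y hy).le
  rw [totalRate, setIntegral_pos_iff_support_of_nonneg_ae hnn hint]
  refine lt_of_lt_of_le (hDo.measure_pos volume hDn) (measure_mono fun y hy => ?_)
  exact ⟨(hpos y (subset_closure hy)).ne', subset_closure hy⟩

/-- The probability distribution on `closure D` with density proportional to `λ` (as a measure on
the ambient Euclidean space). -/
noncomputable def densityLaw {d : ℕ} {D : Set (EuclideanSpace ℝ (Fin d))}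
    {lam : EuclideanSpace ℝ (Fin d) → ℝ} (hDo : IsOpen D) (hDn : D.Nonempty)
    (hDb : Bornology.IsBounded D) (hlam : ContinuousOn lam (closure D))
    (hpos : ∀ y ∈ closure D, 0 < lam y) : ProbabilityMeasure (EuclideanSpace ℝ (Fin d)) :=
  ⟨(volume.restrict (closure D)).withDensity fun y => ENNReal.ofReal (lam y / totalRate D lam), by
    have hT := totalRate_pos hDo hDn hDb hlam hpos
    have hint : IntegrableOn lam (closure D) :=
      hlam.integrableOn_compact hDb.isCompact_closure
    have hnn : 0 ≤ᵐ[volume.restrict (closure D)] fun y => lam y / totalRate D lam :=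
      (ae_restrict_mem isClosed_closure.measurableSet).mono fun y hy =>
        div_nonneg (hpos y hy).le hT.le
    refine ⟨?_⟩
    rw [withDensity_apply _ MeasurableSet.univ, Measure.restrict_univ,
      ← ofReal_integral_eq_lintegral_ofReal (hint.div_const _) hnn, integral_div,
      ← totalRate, div_self hT.ne', ENNReal.ofReal_one]⟩

/-! Everything is read off one formula. Say that a law on `LscFun X` has intensity `ν` if, for
disjoint closed `C i` and `t i ≥ 0`, the event `inf_{C i} f ≥ t i` for all `i` has probability `exp
(-∑ t i * ν (C i))`; this is `HasVoidProb`. An extreme value process has intensity `λ dx`. The key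
point is that the law of `W_n`, `n ≥ 1`, satisfies the same formula exactly, with intensity `r •
empiricalMeasure x n`, where `r` is the total rate (`hasVoidProb_map_ofPoints`). Convergence of
`W_n` is thus continuity of the law in its intensity (`tendsto_of_hasVoidProb`).

For continuity, overlapping closed sets are cut into the atoms of the algebra they generate. On an
atom only the largest lower bound matters, so the joint law of the infima is an explicit function of
the masses of the atoms (`eq_exp_atom`). These masses converge if the sets have `ν`-null frontiers.
A countable family of such sets, rich enough to separate a compact set from the complement of an
open one (`exists_isInterpolating`), yields a π-system of box sets containing arbitrarily small
neighbourhoods of every point. Convergence on such a π-system implies weak convergence.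

For existence, a Poisson process on `X × [0, ∞)` is built in independent layers `X × [k, k + 1]`.
The lowest height above each point is a function with the required void probabilities
(`hasVoidProb_map_layerInf`). -/

namespace LscFun

/-! ### Box sets and the topology of Gamma-convergence -/

section Topology

variable {X : Type*} [TopologicalSpace X]

theorem isOpen_infOn_lt {U : Set X} (hU : IsOpen U) (t : ℝ) :
    IsOpen {f : LscFun X | f.infOn U < (t : EReal)} :=
  (inf_le_left : (sigmaPlus X ⊓ sigmaMinus X) ≤ sigmaPlus X) _
    (TopologicalSpace.isOpen_generateFrom_of_mem ⟨U, t, hU, rfl⟩)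

theorem isOpen_lt_infOn {K : Set X} (hK : IsCompact K) (t : ℝ) :
    IsOpen {f : LscFun X | (t : EReal) < f.infOn K} :=
  (inf_le_right : (sigmaPlus X ⊓ sigmaMinus X) ≤ sigmaMinus X) _
    (TopologicalSpace.isOpen_generateFrom_of_mem ⟨K, t, hK, rfl⟩)

theorem infOn_anti (f : LscFun X) {A B : Set X} (h : A ⊆ B) : f.infOn B ≤ f.infOn A :=
  biInf_mono h

theorem le_infOn_iff {f : LscFun X} {A : Set X} {t : EReal} :
    t ≤ f.infOn A ↔ ∀ x ∈ A, t ≤ f.toFun x :=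
  le_iInf₂_iff

theorem infOn_lt_iff {f : LscFun X} {A : Set X} {t : EReal} :
    f.infOn A < t ↔ ∃ x ∈ A, f.toFun x < t := by
  simp [infOn, iInf_lt_iff]

theorem measurable_infOn {K : Set X} (hK : IsCompact K) :
    Measurable fun f : LscFun X => f.infOn K := by
  refine measurable_of_Ioi fun a => ?_
  induction a with
  | bot =>
    have : (fun f : LscFun X => f.infOn K) ⁻¹' Set.Ioi ⊥
        = ⋃ n : ℕ, {f | ((-n : ℝ) : EReal) < f.infOn K} := by
      ext f
      simp only [Set.mem_preimage, Set.mem_Ioi, Set.mem_iUnion, Set.mem_ofPred_eq]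
      refine ⟨fun h => ?_, fun ⟨n, h⟩ => (EReal.bot_lt_coe _).trans h⟩
      obtain ⟨q, -, hq⟩ := EReal.lt_iff_exists_rat_btwn.1 h
      obtain ⟨n, hn⟩ := exists_nat_gt (-(q : ℝ))
      exact ⟨n, lt_trans (EReal.coe_lt_coe_iff.2 (by linarith)) hq⟩
    rw [this]
    exact MeasurableSet.iUnion fun n => (isOpen_lt_infOn hK _).measurableSet
  | coe t => exact (isOpen_lt_infOn hK t).measurableSet
  | top => simp

/-- The set of all `f` whose infima over the members of the family `Q` satisfy finitely many lower
bounds, indexed by `I`, and finitely many strict upper bounds, indexed by `J`. -/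
def boxSet {α : Type*} (Q : α → Set X) (I J : Finset (α × ℚ)) : Set (LscFun X) :=
  {f | (∀ p ∈ I, ((p.2 : ℝ) : EReal) ≤ f.infOn (Q p.1)) ∧
    ∀ p ∈ J, f.infOn (Q p.1) < ((p.2 : ℝ) : EReal)}

theorem boxSet_inter {α : Type*} [DecidableEq α] (Q : α → Set X) (I J I' J' : Finset (α × ℚ)) :
    boxSet Q I J ∩ boxSet Q I' J' = boxSet Q (I ∪ I') (J ∪ J') := by
  ext f
  simp only [boxSet, Set.mem_inter_iff, Set.mem_ofPred_eq, Finset.mem_union]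
  grind

theorem measurableSet_boxSet {α : Type*} {Q : α → Set X} (hQ : ∀ a, IsCompact (Q a))
    (I J : Finset (α × ℚ)) : MeasurableSet (boxSet Q I J) := by
  have : boxSet Q I J = (⋂ p ∈ I, {f | ((p.2 : ℝ) : EReal) ≤ f.infOn (Q p.1)}) ∩
      ⋂ p ∈ J, {f | f.infOn (Q p.1) < ((p.2 : ℝ) : EReal)} := by
    ext f
    simp [boxSet]
  rw [this]
  exact (Finset.measurableSet_biInter _ fun p _ =>
      measurableSet_le measurable_const (measurable_infOn (hQ _))).inter
    (Finset.measurableSet_biInter _ fun p _ =>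
      measurableSet_lt (measurable_infOn (hQ _)) measurable_const)

/-- Every inclusion of a compact set in an open set is interpolated by a member of `Q`. -/
def IsInterpolating {α : Type*} (Q : α → Set X) : Prop :=
  ∀ K U : Set X, IsCompact K → IsOpen U → K ⊆ U → ∃ a, K ⊆ interior (Q a) ∧ Q a ⊆ U

/-- Box sets need not be open, but they shrink to neighbourhoods. For an upper bound, interpolate
between a point where `f` is small and `U`; for a lower bound, between `K` and a superlevel set of
`f`, open by lower semicontinuity. -/
theorem exists_boxSet_mem_nhds {α : Type*} {Q : α → Set X} (hQc : ∀ a, IsCompact (Q a))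
    (hQ : IsInterpolating Q) {G : Set (LscFun X)} (hG : IsOpen G) :
    ∀ f ∈ G, ∃ I J, boxSet Q I J ∈ 𝓝 f ∧ boxSet Q I J ⊆ G := by
  classical
  have hG' : TopologicalSpace.GenerateOpen
      ({S | ∃ (U : Set X) (t : ℝ), IsOpen U ∧ S = {f : LscFun X | f.infOn U < (t : EReal)}} ∪
        {S | ∃ (K : Set X) (t : ℝ), IsCompact K ∧
          S = {f : LscFun X | (t : EReal) < f.infOn K}}) G := by
    have h : IsOpen[sigmaPlus X ⊓ sigmaMinus X] G := hG
    rw [← generateFrom_union] at h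
    exact h
  clear hG
  induction hG' with
  | basic s hs =>
    intro f hf
    rcases hs with ⟨U, t, hU, rfl⟩ | ⟨K, t, hK, rfl⟩
    · obtain ⟨y, hyU, hy⟩ := infOn_lt_iff.1 hf
      obtain ⟨q, hyq, hqt⟩ := EReal.lt_iff_exists_rat_btwn.1 hy
      obtain ⟨a, ha, haU⟩ := hQ {y} U isCompact_singleton hU (by simpa using hyU)
      refine ⟨∅, {(a, q)}, ?_, ?_⟩
      · filter_upwards [(isOpen_infOn_lt (isOpen_interior (s := Q a)) q).mem_nhds
          (infOn_lt_iff.2 ⟨y, ha rfl, hyq⟩)] with g hg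
        exact ⟨by simp, by simpa using (infOn_anti g interior_subset).trans_lt hg⟩
      · rintro g ⟨-, hg⟩
        have := hg (a, q) (by simp)
        exact ((infOn_anti g haU).trans_lt this).trans hqt
    -- Two rationals are needed: the infimum over `Q a` is only known to be at least `q'`, while the
    -- open neighbourhood of `f` requires it to exceed `q` strictly.
    · obtain ⟨q', htq', hq'⟩ := EReal.lt_iff_exists_rat_btwn.1 hf
      obtain ⟨q, htq, hq⟩ := EReal.lt_iff_exists_rat_btwn.1 htq'
      obtain ⟨a, ha, haU⟩ := hQ K {x | ((q' : ℝ) : EReal) < f.toFun x} hK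
        (f.lowerSemicontinuous.isOpen_preimage _)
        (fun x hx => hq'.trans_le (le_infOn_iff.1 le_rfl x hx))
      refine ⟨{(a, q)}, ∅, ?_, ?_⟩
      · have : ((q : ℝ) : EReal) < f.infOn (Q a) :=
          hq.trans_le (le_infOn_iff.2 fun x hx => (haU hx).le)
        filter_upwards [(isOpen_lt_infOn (hQc a) q).mem_nhds this] with g hg
        exact ⟨by simpa using le_of_lt hg, by simp⟩
      · rintro g ⟨hg, -⟩
        have := hg (a, q) (by simp)
        exact htq.trans_le (this.trans (infOn_anti g (ha.trans interior_subset)))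
  | univ => exact fun f _ => ⟨∅, ∅, by simp [boxSet], by simp⟩
  | inter s t _ _ hs ht =>
    rintro f ⟨hfs, hft⟩
    obtain ⟨I, J, h1, h2⟩ := hs f hfs
    obtain ⟨I', J', h1', h2'⟩ := ht f hft
    refine ⟨I ∪ I', J ∪ J', ?_, ?_⟩
    · rw [← boxSet_inter]
      exact inter_mem h1 h1'
    · rw [← boxSet_inter]
      exact Set.inter_subset_inter h2 h2'
  | sUnion S _ ih =>
    rintro f ⟨s, hs, hfs⟩
    obtain ⟨I, J, h1, h2⟩ := ih s hs f hfs
    exact ⟨I, J, h1, h2.trans (Set.subset_sUnion_of_mem hs)⟩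

theorem secondCountableTopology_of_isInterpolating {α : Type*} [Countable α] {Q : α → Set X}
    (hQc : ∀ a, IsCompact (Q a)) (hQ : IsInterpolating Q) :
    SecondCountableTopology (LscFun X) := by
  refine TopologicalSpace.IsTopologicalBasis.secondCountableTopology
    (b := Set.range fun p : Finset (α × ℚ) × Finset (α × ℚ) => interior (boxSet Q p.1 p.2)) ?_
    (Set.countable_range _)
  refine TopologicalSpace.isTopologicalBasis_of_isOpen_of_nhds ?_ ?_
  · rintro _ ⟨p, rfl⟩
    exact isOpen_interior
  · intro f G hf hG
    obtain ⟨I, J, h1, h2⟩ := exists_boxSet_mem_nhds hQc hQ hG f hf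
    exact ⟨_, ⟨(I, J), rfl⟩, mem_interior_iff_mem_nhds.2 h1, interior_subset.trans h2⟩

/-- There are only countably many box sets, so every open set is a countable union of them. -/
theorem measurable_of_infOn {α : Type*} [Countable α] {Q : α → Set X}
    (hQc : ∀ a, IsCompact (Q a)) (hQ : IsInterpolating Q) {Ω : Type*} [MeasurableSpace Ω]
    {W : Ω → LscFun X} (hW : ∀ K, IsCompact K → Measurable fun ω => (W ω).infOn K) :
    Measurable W := by
  refine measurable_of_isOpen fun G hG => ?_
  have : G = ⋃ p ∈ {p : Finset (α × ℚ) × Finset (α × ℚ) | boxSet Q p.1 p.2 ⊆ G},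
      boxSet Q p.1 p.2 := by
    refine Set.Subset.antisymm (fun f hf => ?_) (Set.iUnion₂_subset fun p hp => hp)
    obtain ⟨I, J, h1, h2⟩ := exists_boxSet_mem_nhds hQc hQ hG f hf
    exact Set.mem_biUnion (x := (I, J)) h2 (mem_of_mem_nhds h1)
  rw [this, Set.preimage_iUnion₂]
  refine MeasurableSet.biUnion (Set.to_countable _) fun p _ => ?_
  have : W ⁻¹' boxSet Q p.1 p.2 =
      (⋂ r ∈ p.1, {ω | ((r.2 : ℝ) : EReal) ≤ (W ω).infOn (Q r.1)}) ∩
      ⋂ r ∈ p.2, {ω | (W ω).infOn (Q r.1) < ((r.2 : ℝ) : EReal)} := by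
    ext ω
    simp [boxSet]
  rw [this]
  exact (Finset.measurableSet_biInter _ fun r _ =>
      measurableSet_le measurable_const (hW _ (hQc _))).inter
    (Finset.measurableSet_biInter _ fun r _ =>
      measurableSet_lt (hW _ (hQc _)) measurable_const)

end Topology

/-! ### Interpolating families with null frontiers in compact metric spaces -/

section Interpolating

universe u

variable {X : Type u} [PseudoMetricSpace X] [CompactSpace X]

/-- Balls with `μ`-null frontier exist at arbitrarily small radii, so open sets with null frontier
form a basis. The family consists of the closures of finite unions from a countable subbasis of it
that is still a basis; compactness gives the interpolation. -/
theorem exists_isInterpolating [MeasurableSpace X] [OpensMeasurableSpace X] (μ : Measure X)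
    [SFinite μ] :
    ∃ (α : Type u) (_ : Countable α) (Q : α → Set X), (∀ a, IsClosed (Q a)) ∧
      (∀ a, μ (frontier (Q a)) = 0) ∧ IsInterpolating Q := by
  have hbasis : TopologicalSpace.IsTopologicalBasis
      {U : Set X | IsOpen U ∧ μ (frontier U) = 0} := by
    refine TopologicalSpace.isTopologicalBasis_of_isOpen_of_nhds (fun U hU => hU.1) ?_
    intro x U hx hU
    obtain ⟨ε, hε, hb⟩ := Metric.isOpen_iff.1 hU x hx
    obtain ⟨r, hr, hr0⟩ := exists_null_frontier_thickening μ {x} hε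
    refine ⟨_, ⟨Metric.isOpen_thickening, hr0⟩, ?_, ?_⟩
    · simp [hr.1]
    · rw [Metric.thickening_singleton]
      exact (Metric.ball_subset_ball hr.2.le).trans hb
  obtain ⟨b, hb, hbc, hbb⟩ := hbasis.exists_countable
  have := hbc.to_subtype
  classical
  refine ⟨Finset b, inferInstance, fun F => closure (⋃ u ∈ F, (u : Set X)),
    fun _ => isClosed_closure, fun F => ?_, ?_⟩
  · refine measure_mono_null frontier_closure_subset ?_
    induction F using Finset.cons_induction with
    | empty => simp
    | cons u F hu ih =>
      rw [Finset.cons_eq_insert, Finset.set_biUnion_insert]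
      refine measure_mono_null (frontier_union_subset _ _) (measure_union_null ?_ ?_)
      · exact measure_mono_null Set.inter_subset_left (hb u.2).2
      · exact measure_mono_null Set.inter_subset_right ih
  · intro K U hK hU hKU
    obtain ⟨V, hVo, hKV, hVU⟩ : ∃ V, IsOpen V ∧ K ⊆ V ∧ closure V ⊆ U := by
      obtain ⟨δ, hδ, h⟩ := hK.exists_cthickening_subset_open hU hKU
      exact ⟨Metric.thickening δ K, Metric.isOpen_thickening, Metric.self_subset_thickening hδ K,
        (Metric.closure_thickening_subset_cthickening δ K).trans h⟩
    have hcov : K ⊆ ⋃ u : {u : b // (u : Set X) ⊆ V}, (u.1 : Set X) := by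
      intro x hx
      obtain ⟨u, hub, hxu, huV⟩ := hbb.exists_subset_of_mem_open (hKV hx) hVo
      exact Set.mem_iUnion.2 ⟨⟨⟨u, hub⟩, huV⟩, hxu⟩
    obtain ⟨t, ht⟩ := hK.elim_finite_subcover _ (fun u => hbb.isOpen u.1.2) hcov
    refine ⟨t.map ⟨Subtype.val, Subtype.val_injective⟩, ?_, ?_⟩
    · refine ht.trans (Set.iUnion₂_subset fun u hu => interior_maximal ?_ (hbb.isOpen u.1.2))
      have hmem := Finset.mem_map_of_mem ⟨Subtype.val, Subtype.val_injective⟩ hu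
      exact Set.Subset.trans (fun x hx => Set.mem_iUnion₂.2 ⟨u.1, hmem, hx⟩) subset_closure
    · refine (closure_mono ?_).trans hVU
      simp only [Finset.mem_map, Function.Embedding.coeFn_mk, Set.iUnion_subset_iff]
      rintro u ⟨v, -, rfl⟩
      exact v.2

instance : SecondCountableTopology (LscFun X) := by
  borelize X
  obtain ⟨α, _, Q, hQc, -, hQ⟩ := exists_isInterpolating (0 : Measure X)
  exact secondCountableTopology_of_isInterpolating (fun a => (hQc a).isCompact) hQ

theorem measurable_iff_infOn {Ω : Type*} [MeasurableSpace Ω] {W : Ω → LscFun X} :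
    Measurable W ↔ ∀ K, IsCompact K → Measurable fun ω => (W ω).infOn K := by
  refine ⟨fun hW K hK => (measurable_infOn hK).comp hW, fun hW => ?_⟩
  borelize X
  obtain ⟨α, _, Q, hQc, -, hQ⟩ := exists_isInterpolating (0 : Measure X)
  exact measurable_of_infOn (fun a => (hQc a).isCompact) hQ hW

end Interpolating

end LscFun

/-! ### Atoms of a finite family of closed sets -/

namespace LscFun

section Atom

/-- The set of the points that lie in `Q i` exactly for the indices `i ∈ J`. -/
def atom {X ι : Type*} (Q : ι → Set X) (J : Finset ι) : Set X := {x | ∀ i, x ∈ Q i ↔ i ∈ J}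

theorem disjoint_atom {X ι : Type*} (Q : ι → Set X) {J J' : Finset ι} (h : J ≠ J') :
    Disjoint (atom Q J) (atom Q J') :=
  Set.disjoint_left.2 fun _ hx hx' => h (Finset.ext fun i => (hx i).symm.trans (hx' i))

theorem atom_eq_inter {X ι : Type*} (Q : ι → Set X) (J : Finset ι) :
    atom Q J = (⋂ i ∈ J, Q i) ∩ ⋂ i ∈ {i | i ∉ J}, (Q i)ᶜ := by
  ext x
  simp only [atom, Set.mem_ofPred_eq, Set.mem_inter_iff, Set.mem_iInter, Set.mem_compl_iff]
  grind

/-- An atom is the intersection of a closed and an open set, and open sets are increasing unions of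
closed sets here. This lets the void formula, given for closed sets, reach atoms. -/
theorem exists_atom_eq_iUnion {X ι : Type*} [PseudoEMetricSpace X] [Finite ι] {Q : ι → Set X}
    (hQ : ∀ i, IsClosed (Q i)) (J : Finset ι) :
    ∃ F : ℕ → Set X, (∀ n, IsClosed (F n)) ∧ ⋃ n, F n = atom Q J ∧ Monotone F := by
  have ho : IsOpen (⋂ i ∈ {i | i ∉ J}, (Q i)ᶜ) :=
    (Set.toFinite _).isOpen_biInter fun i _ => (hQ i).isOpen_compl
  obtain ⟨F, hF, -, hFU, hFm⟩ := ho.exists_iUnion_isClosed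
  refine ⟨fun n => (⋂ i ∈ J, Q i) ∩ F n,
    fun n => (isClosed_biInter fun i _ => hQ i).inter (hF n), ?_,
    fun n m h => Set.inter_subset_inter_right _ (hFm h)⟩
  rw [← Set.inter_iUnion, hFU, atom_eq_inter]

theorem measure_frontier_iInter_eq_zero {X ι : Type*} [TopologicalSpace X] [MeasurableSpace X] {ν : Measure X}
    [Finite ι] {Q : ι → Set X}
    (hQ : ∀ i, ν (frontier (Q i)) = 0) : ν (frontier (⋂ i, Q i)) = 0 := by
  classical
  have := Fintype.ofFinite ι
  have key : ∀ s : Finset ι, ν (frontier (⋂ i ∈ s, Q i)) = 0 := by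
    intro s
    induction s using Finset.induction_on with
    | empty => simp
    | insert i s hi ih =>
      rw [Finset.set_biInter_insert]
      refine measure_mono_null (frontier_inter_subset _ _) (measure_union_null ?_ ?_)
      · exact measure_mono_null Set.inter_subset_left (hQ i)
      · exact measure_mono_null Set.inter_subset_right ih
  simpa using key Finset.univ

theorem measure_frontier_atom_eq_zero {X ι : Type*} [TopologicalSpace X] [MeasurableSpace X] {ν : Measure X}
    [Finite ι] {Q : ι → Set X}
    (hQ : ∀ i, ν (frontier (Q i)) = 0) (J : Finset ι) : ν (frontier (atom Q J)) = 0 := by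
  classical
  have : atom Q J = ⋂ i, if i ∈ J then Q i else (Q i)ᶜ := by
    ext x
    simp only [atom, Set.mem_ofPred_eq, Set.mem_iInter]
    refine forall_congr' fun i => ?_
    split_ifs with h <;> simp [h]
  rw [this]
  refine measure_frontier_iInter_eq_zero fun i => ?_
  split_ifs <;> simp [hQ i]

end Atom

/-! ### Void probabilities and weak convergence -/

section VoidProb

theorem measurableSet_le_infOn {X ι : Type*} [TopologicalSpace X] [CompactSpace X] [Countable ι] {C : ι → Set X}
    (hC : ∀ i, IsClosed (C i)) (t : ι → EReal) :
    MeasurableSet {f : LscFun X | ∀ i, t i ≤ f.infOn (C i)} := by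
  rw [Set.ofPred_forall]
  exact MeasurableSet.iInter fun i =>
    measurableSet_le measurable_const (measurable_infOn (hC i).isCompact)

variable {X : Type*} [PseudoMetricSpace X] [MeasurableSpace X]

/-- The law `κ` of a random lower semicontinuous function has void probabilities of intensity `ν`
if the infima over disjoint closed sets `C i` are independent and exponential with rates
`ν (C i)`. -/
def HasVoidProb (κ : Measure (LscFun X)) (ν : Measure X) : Prop :=
  ∀ (k : ℕ) (C : Fin k → Set X) (t : Fin k → ℝ≥0), (∀ i, IsClosed (C i)) →
    Pairwise (fun i j => Disjoint (C i) (C j)) →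
    κ.real {f | ∀ i, ((t i : ℝ) : EReal) ≤ f.infOn (C i)} = Real.exp (-∑ i, t i * ν.real (C i))

variable {κ : Measure (LscFun X)} {ν : Measure X}

theorem HasVoidProb.of_fintype (h : HasVoidProb κ ν) {ι : Type*} [Fintype ι]
    {C : ι → Set X} (t : ι → ℝ≥0) (hC : ∀ i, IsClosed (C i))
    (hd : Pairwise (fun i j => Disjoint (C i) (C j))) :
    κ.real {f | ∀ i, ((t i : ℝ) : EReal) ≤ f.infOn (C i)} =
      Real.exp (-∑ i, t i * ν.real (C i)) := by
  let e := Fintype.equivFin ι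
  have := h _ (C ∘ e.symm) (t ∘ e.symm) (fun i => hC _)
    (fun i j hij => hd (e.symm.injective.ne hij))
  simp only [Function.comp_apply] at this
  rw [Equiv.sum_comp e.symm (fun i => (t i : ℝ) * ν.real (C i))] at this
  rw [← this]
  congr 1
  ext f
  exact e.symm.forall_congr_right.symm

variable [CompactSpace X]

/-- The void formula for the whole space with threshold `0` gives `exp 0 = 1`. -/
theorem HasVoidProb.ae_nonneg [IsProbabilityMeasure κ] (h : HasVoidProb κ ν) :
    ∀ᵐ f ∂κ, ∀ x, 0 ≤ f.toFun x := by
  have h1 := h 1 (fun _ => Set.univ) 0 (fun _ => isClosed_univ) (fun i j hij =>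
    absurd (Subsingleton.elim i j) hij)
  have hm := measurableSet_le_infOn (X := X) (fun _ : Fin 1 => isClosed_univ) 0
  have : κ {f : LscFun X | ∀ i : Fin 1, (0 : Fin 1 → EReal) i ≤ f.infOn Set.univ} = 1 := by
    rw [← ENNReal.toReal_eq_one_iff]
    simpa [Measure.real] using h1
  have h2 := (prob_compl_eq_zero_iff hm).2 this
  filter_upwards [compl_mem_ae_iff.2 h2] with f hf x
  exact le_infOn_iff.1 (by simpa using hf) x (Set.mem_univ x)

/-- Continuity from above for `κ` and from below for `ν`. -/
theorem HasVoidProb.of_iUnion [IsFiniteMeasure κ] [IsFiniteMeasure ν] (h : HasVoidProb κ ν)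
    {ι : Type*} [Fintype ι] {C : ι → ℕ → Set X} (t : ι → ℝ≥0) (hC : ∀ i n, IsClosed (C i n))
    (hmono : ∀ i, Monotone (C i))
    (hd : Pairwise (fun i j => Disjoint (⋃ n, C i n) (⋃ n, C j n))) :
    κ.real {f | ∀ i, ((t i : ℝ) : EReal) ≤ f.infOn (⋃ n, C i n)} =
      Real.exp (-∑ i, t i * ν.real (⋃ n, C i n)) := by
  have hset : {f : LscFun X | ∀ i, ((t i : ℝ) : EReal) ≤ f.infOn (⋃ n, C i n)} =
      ⋂ n, {f | ∀ i, ((t i : ℝ) : EReal) ≤ f.infOn (C i n)} := by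
    ext f
    simp only [Set.mem_ofPred_eq, Set.mem_iInter, le_infOn_iff, Set.mem_iUnion]
    exact ⟨fun H n i x hx => H i x ⟨n, hx⟩, fun H i x ⟨n, hx⟩ => H n i x hx⟩
  have hleft : Tendsto (fun n => κ.real {f | ∀ i, ((t i : ℝ) : EReal) ≤ f.infOn (C i n)}) atTop
      (𝓝 (κ.real {f | ∀ i, ((t i : ℝ) : EReal) ≤ f.infOn (⋃ n, C i n)})) := by
    rw [hset]
    refine (ENNReal.tendsto_toReal (measure_ne_top _ _)).comp (tendsto_measure_iInter_atTop
      (fun n => (measurableSet_le_infOn (fun i => hC i n) _).nullMeasurableSet) ?_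
      ⟨0, measure_ne_top _ _⟩)
    exact fun n m hnm f hf i => (hf i).trans (infOn_anti f (hmono i hnm))
  refine tendsto_nhds_unique hleft ?_
  have : ∀ n, κ.real {f | ∀ i, ((t i : ℝ) : EReal) ≤ f.infOn (C i n)} =
      Real.exp (-∑ i, t i * ν.real (C i n)) := fun n => h.of_fintype t (fun i => hC i n)
    fun i j hij => (hd hij).mono (Set.subset_iUnion _ n) (Set.subset_iUnion _ n)
  simp_rw [this]
  refine (Real.continuous_exp.tendsto _).comp (tendsto_finsetSum _ fun i _ => ?_).neg
  exact ((ENNReal.tendsto_toReal (measure_ne_top _ _)).comp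
    (tendsto_measure_iUnion_atTop (hmono i))).const_mul _

open scoped Classical in
-- On the atom of `J` the active bounds are those with index in `J`, so together they say `f ≥
-- max_{i ∈ J} t i`; negative bounds may be raised to `0` almost surely. The atoms are disjoint, so
-- `of_iUnion` applies.
theorem HasVoidProb.eq_exp_atom [IsProbabilityMeasure κ] [IsFiniteMeasure ν]
    (h : HasVoidProb κ ν) {ι : Type*} [Fintype ι] {Q : ι → Set X} (t : ι → ℝ)
    (hQ : ∀ i, IsClosed (Q i)) :
    κ.real {f | ∀ i, ((t i : ℝ) : EReal) ≤ f.infOn (Q i)} =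
      Real.exp (-∑ J : Finset ι, (J.sup fun i => (t i).toNNReal : ℝ≥0) * ν.real (atom Q J)) := by
  choose F hFc hFU hFm using exists_atom_eq_iUnion hQ
  have key := h.of_iUnion (C := F) (fun J => J.sup fun i => (t i).toNNReal) hFc hFm
    (fun J J' hJ => by simpa only [hFU] using disjoint_atom Q hJ)
  simp only [hFU] at key
  rw [← key]
  refine measureReal_congr ?_
  filter_upwards [h.ae_nonneg] with f hf
  refine propext ⟨fun H J => le_infOn_iff.2 fun x hx => ?_, fun H i => le_infOn_iff.2 fun x hx => ?_⟩
  -- The empty supremum is `0`, so outside all `Q i` the constraint is just nonnegativity.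
  · rcases J.eq_empty_or_nonempty with rfl | hJ
    · simpa using hf x
    · obtain ⟨i, hi, hs⟩ := Finset.exists_mem_eq_sup J hJ fun i => (t i).toNNReal
      rw [hs, Real.coe_toNNReal', EReal.coe_strictMono.monotone.map_max]
      exact max_le (le_infOn_iff.1 (H i) x ((hx i).2 hi)) (hf x)
  · have h1 := le_infOn_iff.1 (H (Finset.univ.filter fun i => x ∈ Q i)) x (by simp [atom])
    refine le_trans (EReal.coe_le_coe_iff.2 ?_) h1
    exact (Real.le_coe_toNNReal _).trans (NNReal.coe_le_coe.2
      (Finset.le_sup (f := fun i => (t i).toNNReal) (by simpa using hx)))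

/-- Without upper bounds this is convergence of the masses of the atoms. Upper bounds are removed
one at a time, as in inclusion-exclusion. -/
theorem tendsto_boxSet_of_hasVoidProb {κs : ℕ → Measure (LscFun X)}
    [∀ n, IsProbabilityMeasure (κs n)] [IsProbabilityMeasure κ] {νs : ℕ → Measure X}
    [∀ n, IsFiniteMeasure (νs n)] [IsFiniteMeasure ν]
    (hs : ∀ᶠ n in atTop, HasVoidProb (κs n) (νs n)) (h : HasVoidProb κ ν)
    (hlim : ∀ A, ν (frontier A) = 0 → Tendsto (fun n => (νs n).real A) atTop (𝓝 (ν.real A)))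
    {α : Type*} {Q : α → Set X} (hQc : ∀ a, IsClosed (Q a)) (hQ0 : ∀ a, ν (frontier (Q a)) = 0)
    (I J : Finset (α × ℚ)) :
    Tendsto (fun n => (κs n).real (boxSet Q I J)) atTop (𝓝 (κ.real (boxSet Q I J))) := by
  classical
  induction J using Finset.induction_on generalizing I with
  | empty =>
    have hbox : boxSet Q I ∅ =
        {f | ∀ p : I, (((p.1.2 : ℚ) : ℝ) : EReal) ≤ f.infOn (Q p.1.1)} := by
      ext f
      simp [boxSet]
    rw [hbox, h.eq_exp_atom (fun p : I => ((p.1.2 : ℚ) : ℝ)) (fun p => hQc _)]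
    refine Tendsto.congr' (hs.mono fun n hn =>
      (hn.eq_exp_atom (fun p : I => ((p.1.2 : ℚ) : ℝ)) (fun p => hQc _)).symm) ?_
    refine (Real.continuous_exp.tendsto _).comp (tendsto_finsetSum _ fun J _ => ?_).neg
    exact (hlim _ (measure_frontier_atom_eq_zero (fun p => hQ0 _) J)).const_mul _
  | insert p J hp ih =>
    -- A strict upper bound is the negation of the corresponding weak lower bound.
    have hbox : boxSet Q I (insert p J) = boxSet Q I J \ boxSet Q (insert p I) J := by
      ext f
      simp only [boxSet, Set.mem_ofPred_eq, Set.mem_sdiff, Finset.forall_mem_insert, ← not_le]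
      tauto
    have hsub : boxSet Q (insert p I) J ⊆ boxSet Q I J :=
      fun f hf => ⟨fun r hr => hf.1 r (Finset.mem_insert_of_mem hr), hf.2⟩
    have hm := measurableSet_boxSet (fun a => (hQc a).isCompact) (insert p I) J
    have hdiff : ∀ (μ : Measure (LscFun X)) [IsProbabilityMeasure μ],
        μ.real (boxSet Q I (insert p J)) =
          μ.real (boxSet Q I J) - μ.real (boxSet Q (insert p I) J) := fun μ _ => by
      rw [hbox, measureReal_sdiff hsub hm]
    simp only [hdiff]
    exact (ih I).sub (ih (insert p I))

variable [BorelSpace X]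

theorem tendsto_of_hasVoidProb {κs : ℕ → ProbabilityMeasure (LscFun X)}
    {κ : ProbabilityMeasure (LscFun X)} {νs : ℕ → Measure X}
    [∀ n, IsFiniteMeasure (νs n)] [IsFiniteMeasure ν]
    (hs : ∀ᶠ n in atTop, HasVoidProb (κs n : Measure (LscFun X)) (νs n))
    (h : HasVoidProb (κ : Measure (LscFun X)) ν)
    (hlim : ∀ A, ν (frontier A) = 0 → Tendsto (fun n => (νs n).real A) atTop (𝓝 (ν.real A))) :
    Tendsto κs atTop (𝓝 κ) := by
  classical
  obtain ⟨α, _, Q, hQc, hQ0, hQ⟩ := exists_isInterpolating ν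
  have hQc' := fun a => (hQc a).isCompact
  refine IsPiSystem.tendsto_probabilityMeasure_of_tendsto_of_mem
    (S := Set.range fun p : Finset (α × ℚ) × Finset (α × ℚ) => boxSet Q p.1 p.2) ?_ ?_ ?_ ?_
  · rintro _ ⟨p, rfl⟩ _ ⟨r, rfl⟩ -
    exact ⟨(p.1 ∪ r.1, p.2 ∪ r.2), (boxSet_inter _ _ _ _ _).symm⟩
  · rintro _ ⟨p, rfl⟩
    exact measurableSet_boxSet hQc' _ _
  · intro G hG f hf
    obtain ⟨I, J, h1, h2⟩ := exists_boxSet_mem_nhds hQc' hQ hG f hf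
    exact ⟨_, ⟨(I, J), rfl⟩, h1, h2⟩
  · rintro _ ⟨p, rfl⟩
    rw [← NNReal.tendsto_coe]
    exact tendsto_boxSet_of_hasVoidProb hs h hlim hQc hQ0 p.1 p.2

end VoidProb

end LscFun

/-! ### Void probabilities of the approximations `W_n` -/

theorem expMeasure_real_Ici {r : ℝ} (hr : 0 < r) {a : ℝ} (ha : 0 ≤ a) :
    (expMeasure r).real (Set.Ici a) = Real.exp (-(r * a)) := by
  have := isProbabilityMeasure_expMeasure hr
  have hna : (expMeasure r) {a} = 0 := by
    rw [expMeasure, gammaMeasure, withDensity_apply _ (measurableSet_singleton a)]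
    exact setLIntegral_measure_zero _ _ (by simp)
  have h1 : (expMeasure r).real (Set.Iic a) = 1 - Real.exp (-(r * a)) := by
    rw [← cdf_eq_real, cdf_expMeasure_eq hr, if_pos ha]
  have h2 : (expMeasure r).real (Set.Ici a) = (expMeasure r).real (Set.Iic a)ᶜ := by
    rw [Set.compl_Iic]
    refine measureReal_congr ?_
    exact (Ioi_ae_eq_Ici' hna).symm
  rw [h2, probReal_compl_eq_one_sub measurableSet_Iic, h1]
  ring

theorem Finset.sum_ite_mem_of_pairwise_disjoint {X ι M : Type*} [Fintype ι] [AddCommMonoid M]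
    {C : ι → Set X} [∀ i x, Decidable (x ∈ C i)] (hd : Pairwise fun i j => Disjoint (C i) (C j))
    (t : ι → M) {x : X} {i : ι} (hx : x ∈ C i) : (∑ j, if x ∈ C j then t j else 0) = t i := by
  rw [Finset.sum_eq_single i, if_pos hx]
  · exact fun j _ hj => if_neg fun hxj => Set.disjoint_left.1 (hd hj) hxj hx
  · simp

namespace LscFun

theorem le_infOn_ofPoints_iff {X : Type*} [TopologicalSpace X] [T1Space X] {n : ℕ} {x : ℕ → X}
    {v : ℕ → ℝ} {A : Set X} {t : EReal} :
    t ≤ (ofPoints n x v).infOn A ↔ ∀ i < n, x i ∈ A → t ≤ v i := by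
  rw [le_infOn_iff]
  simp only [ofPoints, le_iInf_iff]
  exact ⟨fun h i hi hx => h _ hx i ⟨hi, rfl⟩, fun h y hy i hi => h i hi.1 (hi.2 ▸ hy)⟩

theorem measurable_ofPoints {X : Type*} [MetricSpace X] [CompactSpace X] (n : ℕ) (x : ℕ → X) :
    Measurable fun v : ℕ → ℝ => ofPoints n x v := by
  refine measurable_iff_infOn.2 fun K _ => measurable_of_Ici fun t => ?_
  have : (fun v : ℕ → ℝ => (ofPoints n x v).infOn K) ⁻¹' Set.Ici t =
      ⋂ i, ⋂ (_ : i < n), ⋂ (_ : x i ∈ K), {v : ℕ → ℝ | t ≤ (v i : EReal)} := by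
    ext v
    simp [le_infOn_ofPoints_iff]
  rw [this]
  refine MeasurableSet.iInter fun i => MeasurableSet.iInter fun _ => MeasurableSet.iInter fun _ => ?_
  exact measurableSet_le measurable_const (measurable_coe_real_ereal.comp (measurable_pi_apply i))

theorem empiricalMeasure_real_apply {X : Type*} [MeasurableSpace X] (x : ℕ → X) (n : ℕ) {A : Set X}
    (hA : MeasurableSet A) [DecidablePred (· ∈ A)] :
    (empiricalMeasure x n : Measure X).real A =
      (n : ℝ)⁻¹ * ∑ i ∈ Finset.range n, if x i ∈ A then 1 else 0 := by
  have : (empiricalMeasure x n : Measure X) =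
      ((n : ℝ≥0)⁻¹) • ∑ i ∈ Finset.range n, Measure.dirac (x i) := by
    rw [empiricalMeasure, FiniteMeasure.toMeasure_smul, FiniteMeasure.toMeasure_sum]
    rfl
  rw [this, measureReal_nnreal_smul_apply, measureReal_def, Measure.coe_finsetSum,
    Finset.sum_apply, ENNReal.toReal_sum (by simp)]
  congr 1
  refine Finset.sum_congr rfl fun i _ => ?_
  rw [Measure.dirac_apply' _ hA, Set.indicator_apply]
  split_ifs <;> simp

/-- Each point in `C j` imposes `ξ i ≥ (r / n) * t j`, of probability `exp (-(r / n) * t j)`.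
Multiplying over independent `ξ i` counts the points in each `C j`, and `r / n` times this count is
the mass of `C j`. -/
theorem hasVoidProb_map_ofPoints {X : Type*} [MetricSpace X] [CompactSpace X] [MeasurableSpace X]
    [BorelSpace X] {r : ℝ≥0} (hr : r ≠ 0) {n : ℕ} (hn : n ≠ 0) (x : ℕ → X) {Ω : Type*}
    [MeasurableSpace Ω] {P : Measure Ω} {ξ : ℕ → Ω → ℝ} (hξ : iIndepFun ξ P)
    (hlaw : ∀ i, HasLaw (ξ i) (expMeasure 1) P) :
    HasVoidProb (P.map fun ω => ofPoints n x fun i => (n : ℝ) / r * ξ i ω)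
      (r • empiricalMeasure x n : FiniteMeasure X) := by
  classical
  intro k C t hC hd
  have hae : AEMeasurable (fun ω => ofPoints n x fun i => (n : ℝ) / r * ξ i ω) P :=
    (measurable_ofPoints n x).comp_aemeasurable
      (aemeasurable_pi_lambda _ fun i => (hlaw i).aemeasurable.const_mul _)
  have hr' : (0 : ℝ) < r := by exact_mod_cast pos_iff_ne_zero.2 hr
  have hn' : (0 : ℝ) < n := by exact_mod_cast pos_iff_ne_zero.2 hn
  -- The values allowed for `ξ i`: by disjointness of the `C j`, a single ray or the whole line.
  let S : ℕ → Set ℝ := fun i => ⋂ j, ⋂ (_ : x i ∈ C j), Set.Ici ((r : ℝ) / n * t j)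
  have hS : ∀ i, MeasurableSet (S i) := fun i =>
    MeasurableSet.iInter fun j => MeasurableSet.iInter fun _ => measurableSet_Ici
  have hpre : (fun ω => ofPoints n x fun i => (n : ℝ) / r * ξ i ω) ⁻¹'
      {f | ∀ j, ((t j : ℝ) : EReal) ≤ f.infOn (C j)} = ⋂ i ∈ Finset.range n, ξ i ⁻¹' S i := by
    ext ω
    simp only [Set.mem_preimage, Set.mem_ofPred_eq, le_infOn_ofPoints_iff, EReal.coe_le_coe_iff,
      Set.mem_iInter, Finset.mem_range, S, Set.mem_Ici]
    have : ∀ i j, (t j : ℝ) ≤ n / r * ξ i ω ↔ (r : ℝ) / n * t j ≤ ξ i ω := fun i j => by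
      rw [div_mul_eq_mul_div, le_div_iff₀ hr', div_mul_eq_mul_div, div_le_iff₀ hn']
      constructor <;> intro h <;> linarith
    simp only [this]
    exact ⟨fun h i hi j => h j i hi, fun h j i hi => h i hi j⟩
  have hSi : ∀ i, (expMeasure 1).real (S i) =
      Real.exp (-((r : ℝ) / n * ∑ j, if x i ∈ C j then (t j : ℝ) else 0)) := by
    intro i
    have := isProbabilityMeasure_expMeasure one_pos
    by_cases h : ∃ j, x i ∈ C j
    · obtain ⟨j, hj⟩ := h
      have : S i = Set.Ici ((r : ℝ) / n * t j) := by
        refine Set.Subset.antisymm (Set.iInter₂_subset j hj) (Set.subset_iInter₂ fun l hl => ?_)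
        by_cases hlj : l = j
        · rw [hlj]
        · exact absurd hj (Set.disjoint_left.1 (hd hlj) hl)
      rw [this, expMeasure_real_Ici one_pos (by positivity), one_mul,
        Finset.sum_ite_mem_of_pairwise_disjoint hd (fun j => (t j : ℝ)) hj]
    · push Not at h
      have : S i = Set.univ := by simp [S, h]
      simp [this, h]
  rw [measureReal_def, Measure.map_apply_of_aemeasurable hae (measurableSet_le_infOn hC _), hpre,
    hξ.measure_inter_preimage_eq_mul _ (fun i _ => hS i), ENNReal.toReal_prod]
  have hPi : ∀ i, (P (ξ i ⁻¹' S i)).toReal = (expMeasure 1).real (S i) := fun i => by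
    rw [← (hlaw i).map_eq, measureReal_def, Measure.map_apply_of_aemeasurable
      (hlaw i).aemeasurable (hS i)]
  simp only [hPi, hSi]
  rw [← Real.exp_sum, Finset.sum_neg_distrib, ← Finset.mul_sum, Finset.sum_comm]
  congr 2
  rw [Finset.mul_sum]
  refine Finset.sum_congr rfl fun j _ => ?_
  rw [FiniteMeasure.toMeasure_smul, measureReal_nnreal_smul_apply,
    empiricalMeasure_real_apply x n (hC j).measurableSet]
  have hmul : ∀ i, (if x i ∈ C j then (t j : ℝ) else 0) = t j * if x i ∈ C j then 1 else 0 :=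
    fun i => by split_ifs <;> simp
  simp only [hmul, ← Finset.mul_sum]
  ring

end LscFun

/-! ### Existence through a layered Poisson process -/

/-- The number of points and the points themselves of a Poisson sample with `r` points on average,
distributed according to `μ`; only the first `N` members of the sequence of points are used. -/
noncomputable def poissonSample {Z : Type*} [MeasurableSpace Z] (r : ℝ≥0) (μ : Measure Z) :
    Measure (ℕ × (ℕ → Z)) :=
  (poissonMeasure r).prod (Measure.infinitePi fun _ => μ)

instance {Z : Type*} [MeasurableSpace Z] (r : ℝ≥0) (μ : Measure Z) [IsProbabilityMeasure μ] :
    IsProbabilityMeasure (poissonSample r μ) :=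
  inferInstanceAs (IsProbabilityMeasure ((poissonMeasure r).prod (Measure.infinitePi fun _ => μ)))

theorem measurableSet_forall_lt_mem {Z : Type*} [MeasurableSpace Z] {B : Set Z}
    (hB : MeasurableSet B) : MeasurableSet {p : ℕ × (ℕ → Z) | ∀ i < p.1, p.2 i ∈ B} := by
  simp only [Set.ofPred_forall]
  refine MeasurableSet.iInter fun i => ?_
  have : {p : ℕ × (ℕ → Z) | i < p.1 → p.2 i ∈ B} =
      {p | i < p.1}ᶜ ∪ (fun p : ℕ × (ℕ → Z) => p.2 i) ⁻¹' B := by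
    ext p
    simp only [Set.mem_ofPred_eq, Set.mem_union, Set.mem_compl_iff, Set.mem_preimage]
    tauto
  rw [this]
  exact (measurableSet_lt measurable_const measurable_fst).compl.union
    (((measurable_pi_apply i).comp measurable_snd) hB)

/-- Conditioning on the number of points, the sum `∑ exp (-r) (r q)^n / n!` with `q = μ B` equals
`exp (-r (1 - q))`. -/
theorem poissonSample_forall_lt_mem {Z : Type*} [MeasurableSpace Z] (r : ℝ≥0) (μ : Measure Z)
    [IsProbabilityMeasure μ] {B : Set Z} (hB : MeasurableSet B) :
    poissonSample r μ {p | ∀ i < p.1, p.2 i ∈ B} =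
      ENNReal.ofReal (Real.exp (-(r * μ.real Bᶜ))) := by
  have hq : μ B = ENNReal.ofReal (μ.real B) := (ofReal_measureReal).symm
  rw [poissonSample, Measure.prod_apply (measurableSet_forall_lt_mem hB), poissonMeasure,
    lintegral_sum_measure]
  have hn : ∀ n : ℕ, Measure.infinitePi (fun _ : ℕ => μ)
      (Prod.mk n ⁻¹' {p : ℕ × (ℕ → Z) | ∀ i < p.1, p.2 i ∈ B}) =
        ENNReal.ofReal (μ.real B ^ n) := by
    intro n
    have : Prod.mk n ⁻¹' {p : ℕ × (ℕ → Z) | ∀ i < p.1, p.2 i ∈ B} =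
        Set.pi (Finset.range n : Finset ℕ) fun _ => B := by
      ext z
      simp [Set.mem_pi]
    rw [this, Measure.infinitePi_pi _ (fun _ _ => hB), Finset.prod_const, Finset.card_range, hq,
      ENNReal.ofReal_pow measureReal_nonneg]
  simp only [lintegral_smul_measure, lintegral_dirac, hn, smul_eq_mul]
  have hexp : HasSum (fun n : ℕ => Real.exp (-r) * (r : ℝ) ^ n / n.factorial * μ.real B ^ n)
      (Real.exp (-(r * μ.real Bᶜ))) := by
    have h := (NormedSpace.expSeries_div_hasSum_exp ((r : ℝ) * μ.real B)).mul_left (Real.exp (-r))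
    rw [← Real.exp_eq_exp_ℝ, ← Real.exp_add] at h
    convert! h using 1
    · ext n
      rw [mul_pow]
      ring
    · rw [probReal_compl_eq_one_sub hB]
      congr 1
      ring
  have hnn : ∀ n : ℕ, 0 ≤ Real.exp (-r) * (r : ℝ) ^ n / n.factorial * μ.real B ^ n :=
    fun n => by positivity
  rw [← hexp.tsum_eq, ENNReal.ofReal_tsum_of_nonneg hnn hexp.summable]
  refine tsum_congr fun n => ?_
  rw [ENNReal.ofReal_mul (by positivity)]

/-- The `k`-th summand is the length of `[0, t] ∩ [k, k + 1]`; this reassembles the layers. -/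
theorem sum_range_min_one_sub_toNNReal (t : ℝ) (ht : 0 ≤ t) (K : ℕ) :
    ∑ k ∈ Finset.range K, min 1 (max (t - k) 0) = min t K := by
  induction K with
  | zero => simp [ht]
  | succ K ih =>
    rw [Finset.sum_range_succ, ih]
    push_cast
    rcases le_total t K with h | h
    · rw [max_eq_right (by linarith), min_eq_left h, min_eq_right zero_le_one, add_zero,
        min_eq_left (by linarith)]
    · rw [max_eq_left (by linarith), min_eq_right h]
      rcases le_total t (K + 1) with h' | h'
      · rw [min_eq_left h', min_eq_right (by linarith), add_sub_cancel]
      · rw [min_eq_right h', min_eq_left (by linarith)]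

namespace LscFun

section PoissonInf

variable {X : Type*} [TopologicalSpace X] [T1Space X]

/-- The function whose value at `y` is the smallest of the heights `k + u` of the points `(y, u)`
among the first `(ω k).1` points of the `k`-th sample. -/
noncomputable def layerInf (ω : ℕ → ℕ × (ℕ → X × unitInterval)) : LscFun X where
  toFun y := ⨅ k : ℕ, ⨅ i : ℕ, ⨅ _ : i < (ω k).1 ∧ ((ω k).2 i).1 = y,
    (((k : ℝ) + ((ω k).2 i).2 : ℝ) : EReal)
  lowerSemicontinuous := by
    intro y b hb
    obtain ⟨c, hbc, hc⟩ := EReal.lt_iff_exists_rat_btwn.1 hb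
    obtain ⟨m, hm⟩ := exists_nat_gt (c : ℝ)
    -- Heights below `c < m` occur only in the first `m` layers, hence at finitely many points; away
    -- from those other than `y`, the function is at least `c`.
    let F : Set X := (⋃ k ∈ Finset.range m, ⋃ i ∈ Finset.range (ω k).1, {((ω k).2 i).1}) \ {y}
    have hF : F.Finite := by
      refine Set.Finite.sdiff ?_
      exact (Finset.range m).finite_toSet.biUnion fun k _ =>
        (Finset.range (ω k).1).finite_toSet.biUnion fun i _ => Set.finite_singleton _
    filter_upwards [hF.isClosed.isOpen_compl.mem_nhds (show y ∈ Fᶜ by simp [F])] with z hz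
    refine hbc.trans_le ?_
    by_cases hzy : z = y
    · rw [hzy]
      exact hc.le
    · refine le_iInf fun k => le_iInf fun i => le_iInf fun ⟨hi, hiz⟩ => ?_
      rw [EReal.coe_le_coe_iff]
      have hkm : m ≤ k := by
        by_contra! hk
        refine hz ⟨Set.mem_biUnion (Finset.mem_coe.2 (Finset.mem_range.2 hk)) ?_, hzy⟩
        exact Set.mem_biUnion (Finset.mem_coe.2 (Finset.mem_range.2 hi)) hiz.symm
      have h1 : (m : ℝ) ≤ k := by exact_mod_cast hkm
      have h2 := ((ω k).2 i).2.2.1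
      linarith
  ne_bot := by
    intro y h
    have : (0 : EReal) ≤ ⨅ k : ℕ, ⨅ i : ℕ, ⨅ _ : i < (ω k).1 ∧ ((ω k).2 i).1 = y,
        (((k : ℝ) + ((ω k).2 i).2 : ℝ) : EReal) := by
      refine le_iInf fun k => le_iInf fun i => le_iInf fun _ => ?_
      have h2 := ((ω k).2 i).2.2.1
      exact_mod_cast (by positivity : (0 : ℝ) ≤ (k : ℝ) + ((ω k).2 i).2)
    rw [h] at this
    exact absurd (le_bot_iff.1 this) (by simp)

theorem le_infOn_layerInf_iff {ω : ℕ → ℕ × (ℕ → X × unitInterval)} {A : Set X} {t : EReal} :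
    t ≤ (layerInf ω).infOn A ↔ ∀ k, ∀ i < (ω k).1, ((ω k).2 i).1 ∈ A →
      t ≤ (((k : ℝ) + ((ω k).2 i).2 : ℝ) : EReal) := by
  rw [le_infOn_iff]
  simp only [layerInf, le_iInf_iff]
  exact ⟨fun h k i hi hx => h _ hx k i ⟨hi, rfl⟩, fun h y hy k i hi => h k i hi.1 (hi.2 ▸ hy)⟩

end PoissonInf

variable {X : Type*} [MetricSpace X] [CompactSpace X] [MeasurableSpace X] [BorelSpace X]

theorem measurable_layerInf :
    Measurable (layerInf : (ℕ → ℕ × (ℕ → X × unitInterval)) → LscFun X) := by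
  refine measurable_iff_infOn.2 fun K hK => measurable_of_Ici fun t => ?_
  have : (fun ω : ℕ → ℕ × (ℕ → X × unitInterval) => (layerInf ω).infOn K) ⁻¹' Set.Ici t =
      ⋂ k : ℕ, (fun ω : ℕ → ℕ × (ℕ → X × unitInterval) => ω k) ⁻¹' {p | ∀ i < p.1, p.2 i ∈
        {z : X × unitInterval | z.1 ∈ K → t ≤ (((k : ℝ) + z.2 : ℝ) : EReal)}} := by
    ext ω
    simp [le_infOn_layerInf_iff]
  rw [this]
  refine MeasurableSet.iInter fun k => measurable_pi_apply k (measurableSet_forall_lt_mem ?_)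
  have : {z : X × unitInterval | z.1 ∈ K → t ≤ (((k : ℝ) + z.2 : ℝ) : EReal)} =
      (Prod.fst ⁻¹' K)ᶜ ∪ {z : X × unitInterval | t ≤ (((k : ℝ) + z.2 : ℝ) : EReal)} := by
    ext z
    simp only [Set.mem_ofPred_eq, Set.mem_union, Set.mem_compl_iff, Set.mem_preimage]
    tauto
  rw [this]
  refine (measurable_fst hK.measurableSet).compl.union (measurableSet_le measurable_const ?_)
  exact measurable_coe_real_ereal.comp
    (measurable_const.add (measurable_subtype_coe.comp measurable_snd))

theorem unitInterval_volume_real_lt (a : ℝ) :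
    (volume : Measure unitInterval).real {u | (u : ℝ) < a} = min 1 (max a 0) := by
  rcases le_total a 0 with h | h
  · have : {u : unitInterval | (u : ℝ) < a} = ∅ := by
      ext u
      simpa using h.trans u.2.1
    simp [this, h]
  · rcases le_total a 1 with h1 | h1
    · have : {u : unitInterval | (u : ℝ) < a} = Set.Iio ⟨a, h, h1⟩ := rfl
      rw [this, measureReal_def, unitInterval.volume_Iio, ENNReal.toReal_ofReal h, max_eq_left h,
        min_eq_right h1]
    · rw [max_eq_left h, min_eq_left h1]
      refine le_antisymm measureReal_le_one ?_
      calc (1 : ℝ) = (volume : Measure unitInterval).real (Set.Iio 1) := by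
            simp [measureReal_def]
        _ ≤ _ := measureReal_mono fun u hu => lt_of_lt_of_le (show (u : ℝ) < 1 from hu) h1

/-- The bounds hold iff no Poisson point lies below height `t j` over `C j`. The layers are
independent, and the forbidden regions have total mass `∑ t j * μ (C j)`. -/
theorem hasVoidProb_map_layerInf (r : ℝ≥0) (μ : Measure X) [IsProbabilityMeasure μ] :
    HasVoidProb ((Measure.infinitePi fun _ : ℕ =>
      poissonSample r (μ.prod (volume : Measure unitInterval))).map layerInf) (r • μ) := by
  classical
  intro k C t hC hd
  -- Layers from `K` on lie above all thresholds, so only finitely many layers matter.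
  obtain ⟨K, hK⟩ : ∃ K : ℕ, ∀ j, (t j : ℝ) ≤ K := by
    obtain ⟨K, hK⟩ := exists_nat_ge (∑ j, (t j : ℝ))
    exact ⟨K, fun j => (Finset.single_le_sum (f := fun j => (t j : ℝ))
      (fun _ _ => NNReal.coe_nonneg _) (Finset.mem_univ j)).trans hK⟩
  let B : ℕ → Set (X × unitInterval) := fun m => ⋃ j, C j ×ˢ {u : unitInterval | (u : ℝ) < t j - m}
  have hBm' : ∀ (m : ℕ) j, MeasurableSet (C j ×ˢ {u : unitInterval | (u : ℝ) < t j - m}) := fun m j =>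
    (hC j).measurableSet.prod (measurableSet_lt measurable_subtype_coe measurable_const)
  have hBm : ∀ m, MeasurableSet (B m) := fun m => MeasurableSet.iUnion (hBm' m)
  have hpre : layerInf ⁻¹' {f : LscFun X | ∀ j, ((t j : ℝ) : EReal) ≤ f.infOn (C j)} =
      Set.pi (Finset.range K : Finset ℕ) fun m => {p | ∀ i < p.1, p.2 i ∈ (B m)ᶜ} := by
    ext ω
    simp only [Set.mem_preimage, Set.mem_ofPred_eq, le_infOn_layerInf_iff, EReal.coe_le_coe_iff,
      Set.mem_pi, Finset.mem_coe, Finset.mem_range, B, Set.mem_compl_iff, Set.mem_iUnion,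
      Set.mem_prod, not_exists, not_and, not_lt, tsub_le_iff_left]
    refine ⟨fun h m _ i hi j hx => h j m i hi hx, fun h j m i hi hx => ?_⟩
    by_cases hm : m < K
    · exact h m hm i hi j hx
    · have h1 : (K : ℝ) ≤ m := by exact_mod_cast not_lt.1 hm
      have h2 := ((ω m).2 i).2.2.1
      linarith [hK j]
  have hB : ∀ m, (μ.prod (volume : Measure unitInterval)).real (B m) =
      ∑ j, μ.real (C j) * min 1 (max ((t j : ℝ) - m) 0) := by
    intro m
    rw [measureReal_def, measure_iUnion _ (hBm' m), tsum_fintype,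
      ENNReal.toReal_sum fun _ _ => measure_ne_top _ _]
    · refine Finset.sum_congr rfl fun j _ => ?_
      rw [Measure.prod_prod, ENNReal.toReal_mul, ← unitInterval_volume_real_lt]
      rfl
    · exact fun i j hij => Set.disjoint_prod.2 (Or.inl (hd hij))
  rw [measureReal_def, Measure.map_apply measurable_layerInf (measurableSet_le_infOn hC _), hpre,
    Measure.infinitePi_pi _ fun m _ => measurableSet_forall_lt_mem (hBm m).compl]
  simp only [poissonSample_forall_lt_mem _ _ (hBm _).compl, compl_compl, hB]
  rw [ENNReal.toReal_prod]
  simp only [ENNReal.toReal_ofReal (Real.exp_nonneg _)]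
  rw [← Real.exp_sum, Finset.sum_neg_distrib, ← Finset.mul_sum, Finset.sum_comm]
  congr 2
  simp only [← Finset.mul_sum]
  rw [Finset.mul_sum]
  refine Finset.sum_congr rfl fun j _ => ?_
  rw [sum_range_min_one_sub_toNNReal _ (NNReal.coe_nonneg _), min_eq_left (hK j), measureReal_nnreal_smul_apply]
  ring

theorem exists_hasVoidProb (r : ℝ≥0) (μ : Measure X) [IsProbabilityMeasure μ] :
    ∃ κ : Measure (LscFun X), IsProbabilityMeasure κ ∧ HasVoidProb κ (r • μ) :=
  ⟨_, Measure.isProbabilityMeasure_map measurable_layerInf.aemeasurable,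
    hasVoidProb_map_layerInf r μ⟩

end LscFun

/-! ### Void probabilities versus extreme value processes -/

theorem EReal.borel_eq_generateFrom_Ici_coe :
    (inferInstance : MeasurableSpace EReal) =
      MeasurableSpace.generateFrom (Set.range fun t : ℝ => Set.Ici (t : EReal)) := by
  refine le_antisymm ?_ (MeasurableSpace.generateFrom_le ?_)
  · rw [BorelSpace.measurable_eq (α := EReal), borel_eq_generateFrom_Ici]
    refine MeasurableSpace.generateFrom_le ?_
    rintro _ ⟨a, rfl⟩
    induction a with
    | bot => simp
    | coe t => exact MeasurableSpace.measurableSet_generateFrom ⟨t, rfl⟩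
    | top =>
      have : Set.Ici (⊤ : EReal) = ⋂ n : ℕ, Set.Ici (((n : ℝ)) : EReal) := by
        ext x
        simp only [Set.mem_Ici, Set.mem_iInter]
        refine ⟨fun h n => le_top.trans h, fun h => ?_⟩
        by_contra! hx
        obtain ⟨q, hxq, -⟩ := EReal.lt_iff_exists_rat_btwn.1 hx
        obtain ⟨n, hn⟩ := exists_nat_gt (q : ℝ)
        exact absurd (h n) (not_le.2 (hxq.trans (EReal.coe_lt_coe_iff.2 hn)))
      rw [this]
      exact MeasurableSet.iInter fun n => MeasurableSpace.measurableSet_generateFrom ⟨n, rfl⟩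
  · rintro _ ⟨t, rfl⟩
    exact measurableSet_Ici

theorem EReal.isPiSystem_Ici_coe : IsPiSystem (Set.range fun t : ℝ => Set.Ici (t : EReal)) := by
  rintro _ ⟨s, rfl⟩ _ ⟨t, rfl⟩ -
  exact ⟨max s t, by simp [Set.Ici_inter_Ici, EReal.coe_strictMono.monotone.map_max]⟩

theorem isProbabilityMeasure_extExpMeasure {r : ℝ} (hr : 0 ≤ r) :
    IsProbabilityMeasure (extExpMeasure r) := by
  rw [extExpMeasure]
  split_ifs with h
  · infer_instance
  · have := isProbabilityMeasure_expMeasure (lt_of_le_of_ne hr (Ne.symm h))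
    exact Measure.isProbabilityMeasure_map measurable_coe_real_ereal.aemeasurable

theorem extExpMeasure_real_Ici {r : ℝ} (hr : 0 ≤ r) (t : ℝ) :
    (extExpMeasure r).real (Set.Ici (t : EReal)) = Real.exp (-(t.toNNReal * r)) := by
  rw [extExpMeasure]
  split_ifs with h
  · simp [h, measureReal_def]
  · have hr' : 0 < r := lt_of_le_of_ne hr (Ne.symm h)
    have := isProbabilityMeasure_expMeasure hr'
    have hpre : Real.toEReal ⁻¹' Set.Ici (t : EReal) = Set.Ici t := by
      ext x
      simp
    rw [measureReal_def, Measure.map_apply measurable_coe_real_ereal measurableSet_Ici, hpre,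
      ← measureReal_def]
    rcases le_total 0 t with ht | ht
    · rw [expMeasure_real_Ici hr' ht, Real.coe_toNNReal _ ht, mul_comm]
    · rw [Real.toNNReal_of_nonpos ht, NNReal.coe_zero, zero_mul, neg_zero, Real.exp_zero]
      refine le_antisymm measureReal_le_one ?_
      calc (1 : ℝ) = (expMeasure r).real (Set.Ici 0) := by
            rw [expMeasure_real_Ici hr' le_rfl]
            simp
        _ ≤ _ := measureReal_mono (Set.Ici_subset_Ici.2 ht)

namespace LscFun

section

variable {X : Type*} [PseudoMetricSpace X] [CompactSpace X] [MeasurableSpace X]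
  {κ : Measure (LscFun X)} {ν : Measure X}

theorem HasVoidProb.of_fintype_real [IsProbabilityMeasure κ] (h : HasVoidProb κ ν)
    {ι : Type*} [Fintype ι] {C : ι → Set X} (t : ι → ℝ) (hC : ∀ i, IsClosed (C i))
    (hd : Pairwise (fun i j => Disjoint (C i) (C j))) :
    κ.real {f | ∀ i, ((t i : ℝ) : EReal) ≤ f.infOn (C i)} =
      Real.exp (-∑ i, (t i).toNNReal * ν.real (C i)) := by
  rw [← h.of_fintype (fun i => (t i).toNNReal) hC hd]
  refine measureReal_congr ?_
  filter_upwards [h.ae_nonneg] with f hf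
  refine propext (forall_congr' fun i => ?_)
  rw [Real.coe_toNNReal', EReal.coe_strictMono.monotone.map_max, max_le_iff]
  exact ⟨fun H => ⟨H, le_infOn_iff.2 fun x _ => hf x⟩, fun H => H.1⟩

theorem HasVoidProb.real_le_infOn [IsProbabilityMeasure κ] (h : HasVoidProb κ ν) (t : ℝ)
    {C : Set X} (hC : IsClosed C) :
    κ.real {f | (t : EReal) ≤ f.infOn C} = Real.exp (-(t.toNNReal * ν.real C)) := by
  simpa using h.of_fintype_real (fun _ : Unit => t) (fun _ => hC)
    (fun i j hij => absurd (Subsingleton.elim i j) hij)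

theorem HasVoidProb.hasLaw_infOn [IsProbabilityMeasure κ] (h : HasVoidProb κ ν)
    {C : Set X} (hC : IsClosed C) :
    HasLaw (fun f => f.infOn C) (extExpMeasure (ν.real C)) κ where
  aemeasurable := (measurable_infOn hC.isCompact).aemeasurable
  map_eq := by
    have hm := measurable_infOn hC.isCompact
    have := isProbabilityMeasure_extExpMeasure (measureReal_nonneg (μ := ν) (s := C))
    have := Measure.isProbabilityMeasure_map (μ := κ) hm.aemeasurable
    refine ext_of_generate_finite _ EReal.borel_eq_generateFrom_Ici_coe EReal.isPiSystem_Ici_coe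
      ?_ (by simp)
    rintro _ ⟨t, rfl⟩
    rw [← measureReal_eq_measureReal_iff, extExpMeasure_real_Ici measureReal_nonneg,
      ← h.real_le_infOn t hC, measureReal_def, Measure.map_apply hm measurableSet_Ici]
    rfl

/-- Independence may be tested on the π-system of rays with real endpoints, where the void formula
factorizes. -/
theorem HasVoidProb.iIndepFun_infOn [IsProbabilityMeasure κ] (h : HasVoidProb κ ν)
    {ι : Type*} {C : ι → Set X} (hC : ∀ i, IsClosed (C i))
    (hd : Pairwise (fun i j => Disjoint (C i) (C j))) :
    iIndepFun (fun i f => f.infOn (C i)) κ := by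
  rw [iIndepFun_iff_iIndep]
  refine iIndepSets.iIndep (fun i => (measurable_infOn (hC i).isCompact).comap_le)
    (fun i => Set.preimage (fun f : LscFun X => f.infOn (C i)) ''
      Set.range fun t : ℝ => Set.Ici (t : EReal)) (fun i => ?_) (fun i => ?_) ?_
  · rintro _ ⟨_, ⟨s, rfl⟩, rfl⟩ _ ⟨_, ⟨t, rfl⟩, rfl⟩ -
    exact ⟨Set.Ici (s : EReal) ∩ Set.Ici (t : EReal),
      ⟨max s t, by simp [Set.Ici_inter_Ici, EReal.coe_strictMono.monotone.map_max]⟩, rfl⟩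
  · rw [← MeasurableSpace.comap_generateFrom, ← EReal.borel_eq_generateFrom_Ici_coe]
  · rw [iIndepSets_iff]
    intro s f' hf'
    have hf : ∀ i, ∃ t : ℝ, i ∈ s → f' i = {f : LscFun X | (t : EReal) ≤ f.infOn (C i)} := by
      intro i
      by_cases hi : i ∈ s
      · obtain ⟨_, ⟨t, rfl⟩, ht⟩ := hf' i hi
        exact ⟨t, fun _ => ht.symm⟩
      · exact ⟨0, fun hi' => absurd hi' hi⟩
    choose t ht using hf
    have hinter : ⋂ i ∈ s, f' i =
        {f : LscFun X | ∀ i : s, ((t i : ℝ) : EReal) ≤ f.infOn (C i)} := by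
      ext f
      simp only [Set.mem_iInter, Set.mem_ofPred_eq, Subtype.forall]
      exact forall₂_congr fun i hi => by rw [ht i hi]; rfl
    rw [← ENNReal.toReal_eq_toReal_iff' (measure_ne_top _ _)
      (ENNReal.prod_ne_top fun _ _ => measure_ne_top _ _), ENNReal.toReal_prod, hinter,
      ← measureReal_def, h.of_fintype_real (fun i : s => t i) (fun i => hC i)
        (fun i j hij => hd (Subtype.val_injective.ne hij)), ← Finset.sum_neg_distrib, Real.exp_sum,
      ← Finset.prod_coe_sort s]
    refine Finset.prod_congr rfl fun i _ => ?_
    rw [ht i i.2, ← measureReal_def, h.real_le_infOn _ (hC i)]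

end

section Euclidean

variable {d : ℕ} {D : Set (EuclideanSpace ℝ (Fin d))} {lam : EuclideanSpace ℝ (Fin d) → ℝ}
  {ν : Measure (closure D)}

theorem HasVoidProb.isExtremeValueProcess [CompactSpace (closure D)]
    (hν : ∀ C, IsClosed C → ∫ y in C ∩ closure D, lam y = ν.real (Subtype.val ⁻¹' C))
    {κ : Measure (LscFun (closure D))} [IsProbabilityMeasure κ] (h : HasVoidProb κ ν) :
    IsExtremeValueProcess lam id κ where
  aemeasurable := aemeasurable_id
  hasLaw_min C hC := by
    rw [hν C hC]
    exact h.hasLaw_infOn (hC.preimage continuous_subtype_val)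
  iIndepFun_min k C hC hd := h.iIndepFun_infOn (fun i => (hC i).preimage continuous_subtype_val)
    fun i j hij => (hd hij).preimage _

theorem _root_.IsExtremeValueProcess.hasVoidProb [CompactSpace (closure D)]
    (hν : ∀ C, IsClosed C → ∫ y in C ∩ closure D, lam y = ν.real (Subtype.val ⁻¹' C))
    {Ω : Type*} [MeasurableSpace Ω] {W : Ω → LscFun (closure D)} {P : Measure Ω}
    (h : IsExtremeValueProcess lam W P) : HasVoidProb (P.map W) ν := by
  intro k C t hC hd
  have hinj := Subtype.val_injective (p := fun y => y ∈ closure D)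
  -- Relatively closed subsets of `closure D` are closed in the ambient space, so the defining
  -- properties apply to them.
  have hC' : ∀ i, IsClosed (Subtype.val '' C i) := fun i =>
    isClosed_closure.isClosedEmbedding_subtypeVal.isClosedMap _ (hC i)
  have hpre : ∀ i, Subtype.val ⁻¹' (Subtype.val '' C i) = C i := fun i =>
    Set.preimage_image_eq _ hinj
  have hmin : ∀ i (f : LscFun (closure D)), minOver (Subtype.val '' C i) f = f.infOn (C i) :=
    fun i f => congrArg f.infOn (hpre i)
  have hind := h.iIndepFun_min k (fun i => Subtype.val '' C i) hC'
    (fun i j hij => (Set.disjoint_image_iff hinj).2 (hd hij))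
  have hset : W ⁻¹' {f | ∀ i, ((t i : ℝ) : EReal) ≤ f.infOn (C i)} =
      ⋂ i ∈ Finset.univ, (fun ω => minOver (Subtype.val '' C i) (W ω)) ⁻¹'
        Set.Ici ((t i : ℝ) : EReal) := by
    ext ω
    simp [hmin]
  have hone : ∀ i, (P ((fun ω => minOver (Subtype.val '' C i) (W ω)) ⁻¹'
      Set.Ici ((t i : ℝ) : EReal))).toReal = Real.exp (-(t i * ν.real (C i))) := by
    intro i
    have hl := h.hasLaw_min _ (hC' i)
    rw [← Measure.map_apply_of_aemeasurable hl.aemeasurable measurableSet_Ici, hl.map_eq,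
      ← measureReal_def, hν _ (hC' i), extExpMeasure_real_Ici measureReal_nonneg, hpre,
      Real.toNNReal_coe]
  rw [measureReal_def, Measure.map_apply_of_aemeasurable h.aemeasurable
    (measurableSet_le_infOn hC _), hset,
    hind.measure_inter_preimage_eq_mul _ (fun i _ => measurableSet_Ici), ENNReal.toReal_prod]
  simp only [hone]
  rw [← Real.exp_sum, Finset.sum_neg_distrib]

end Euclidean

end LscFun

/-! ### Empirical measures and the limiting density, moved to `closure D` -/

theorem isProbabilityMeasure_empiricalMeasure {E : Type*} [MeasurableSpace E] (x : ℕ → E) {n : ℕ}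
    (hn : n ≠ 0) : IsProbabilityMeasure (empiricalMeasure x n : Measure E) := by
  refine ⟨?_⟩
  have h := LscFun.empiricalMeasure_real_apply x n MeasurableSet.univ
  have hn' : (n : ℝ) ≠ 0 := by exact_mod_cast hn
  rw [← ENNReal.toReal_eq_one_iff, ← measureReal_def, h]
  simp [hn']

theorem map_empiricalMeasure {E F : Type*} [MeasurableSpace E] [MeasurableSpace F] {f : E → F}
    (hf : Measurable f) (x : ℕ → E) (n : ℕ) :
    (empiricalMeasure x n).map f = empiricalMeasure (fun i => f (x i)) n := by
  classical
  ext A hA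
  rw [FiniteMeasure.toMeasure_map, Measure.map_apply hf hA, ← measureReal_eq_measureReal_iff,
    LscFun.empiricalMeasure_real_apply _ _ (hf hA), LscFun.empiricalMeasure_real_apply _ _ hA]
  rfl

theorem tendsto_empiricalMeasure_real {X : Type*} [PseudoMetricSpace X] [MeasurableSpace X]
    [BorelSpace X] {x : ℕ → X} {μ : ProbabilityMeasure X}
    (h : Tendsto (empiricalMeasure x) atTop (𝓝 μ.toFiniteMeasure)) {A : Set X}
    (hA : (μ : Measure X) (frontier A) = 0) :
    Tendsto (fun n => (empiricalMeasure x n : Measure X).real A) atTop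
      (𝓝 ((μ : Measure X).real A)) := by
  -- The shift discards `n = 0`, where the empirical measure is zero rather than a probability
  -- measure.
  rw [← tendsto_add_atTop_iff_nat 1] at h ⊢
  let p : ℕ → ProbabilityMeasure X := fun n =>
    ⟨empiricalMeasure x (n + 1), isProbabilityMeasure_empiricalMeasure x n.succ_ne_zero⟩
  have hp : Tendsto p atTop (𝓝 μ) :=
    (ProbabilityMeasure.tendsto_nhds_iff_toFiniteMeasure_tendsto_nhds _).2 h
  exact (ENNReal.tendsto_toReal (measure_ne_top _ _)).comp
    (ProbabilityMeasure.tendsto_measure_of_null_frontier_of_tendsto' hp hA)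

section DensityLaw

variable {d : ℕ} {D : Set (EuclideanSpace ℝ (Fin d))} {lam : EuclideanSpace ℝ (Fin d) → ℝ}

/-- The ambient law charges only `closure D`, so its `comap` to the subtype loses no mass. -/
theorem exists_map_val_eq_densityLaw (hDo : IsOpen D) (hDn : D.Nonempty)
    (hDb : Bornology.IsBounded D) (hlam : ContinuousOn lam (closure D))
    (hpos : ∀ y ∈ closure D, 0 < lam y) :
    ∃ μ : ProbabilityMeasure (closure D),
      μ.toFiniteMeasure.map Subtype.val =
        (densityLaw hDo hDn hDb hlam hpos).toFiniteMeasure := by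
  set ρ := densityLaw hDo hDn hDb hlam hpos
  have hemb : MeasurableEmbedding (Subtype.val : closure D → EuclideanSpace ℝ (Fin d)) :=
    MeasurableEmbedding.subtype_coe isClosed_closure.measurableSet
  have hnull : (ρ : Measure (EuclideanSpace ℝ (Fin d))) (closure D)ᶜ = 0 := by
    change ((volume.restrict (closure D)).withDensity _) _ = 0
    refine withDensity_absolutelyContinuous _ _ ?_
    rw [Measure.restrict_apply isClosed_closure.measurableSet.compl]
    simp
  have hmap : ((ρ : Measure (EuclideanSpace ℝ (Fin d))).comap
      (Subtype.val : closure D → _)).map Subtype.val =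
      (ρ : Measure (EuclideanSpace ℝ (Fin d))) := by
    rw [hemb.map_comap, Subtype.range_coe, Measure.restrict_eq_self_of_ae_mem]
    exact mem_ae_iff.2 hnull
  have hprob : IsProbabilityMeasure
      ((ρ : Measure (EuclideanSpace ℝ (Fin d))).comap (Subtype.val : closure D → _)) := by
    refine ⟨?_⟩
    have := congrArg (fun m => m Set.univ) hmap
    simpa [Measure.map_apply hemb.measurable MeasurableSet.univ] using this
  exact ⟨⟨_, hprob⟩, Subtype.ext hmap⟩

theorem setIntegral_eq_totalRate_mul_densityLaw (hDo : IsOpen D) (hDn : D.Nonempty)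
    (hDb : Bornology.IsBounded D) (hlam : ContinuousOn lam (closure D))
    (hpos : ∀ y ∈ closure D, 0 < lam y) {C : Set (EuclideanSpace ℝ (Fin d))}
    (hC : MeasurableSet C) :
    ∫ y in C ∩ closure D, lam y = totalRate D lam *
      (densityLaw hDo hDn hDb hlam hpos : Measure (EuclideanSpace ℝ (Fin d))).real C := by
  have hT := totalRate_pos hDo hDn hDb hlam hpos
  have hint : IntegrableOn lam (closure D) := hlam.integrableOn_compact hDb.isCompact_closure
  have hm : MeasurableSet (closure D) := isClosed_closure.measurableSet
  have hnn : 0 ≤ᵐ[volume.restrict (C ∩ closure D)] fun y => lam y / totalRate D lam :=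
    (ae_restrict_mem (hC.inter hm)).mono fun y hy => div_nonneg (hpos y hy.2).le hT.le
  have : (densityLaw hDo hDn hDb hlam hpos : Measure (EuclideanSpace ℝ (Fin d))) C =
      ENNReal.ofReal (∫ y in C ∩ closure D, lam y / totalRate D lam) := by
    change ((volume.restrict (closure D)).withDensity _) C = _
    rw [withDensity_apply _ hC, Measure.restrict_restrict hC, ofReal_integral_eq_lintegral_ofReal
      ((hint.mono_set Set.inter_subset_right).div_const _) hnn]
  rw [measureReal_def, this, ENNReal.toReal_ofReal (integral_nonneg_of_ae hnn), integral_div,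
    mul_div_cancel₀ _ hT.ne']

end DensityLaw

/-! ### Conclusion -/

theorem mainTheorem4 {d : ℕ} (D : Set (EuclideanSpace ℝ (Fin d)))
    (hDo : IsOpen D) (hDc : IsConnected D) (hDb : Bornology.IsBounded D)
    (lam : EuclideanSpace ℝ (Fin d) → ℝ) (hlam : ContinuousOn lam (closure D))
    (hpos : ∀ y ∈ closure D, 0 < lam y) :
    -- the process `W_λ` exists
    (∃ (Ω' : Type) (_ : MeasurableSpace Ω') (P' : Measure Ω') (W : Ω' → LscFun (closure D)),
      IsProbabilityMeasure P' ∧ IsExtremeValueProcess lam W P') ∧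
    -- the random functions `W_n` converge in law to `W_λ`
    ∀ (Ω' : Type*) (_ : MeasurableSpace Ω') (P' : Measure Ω') [IsProbabilityMeasure P']
      (W : Ω' → LscFun (closure D)), IsExtremeValueProcess lam W P' →
    ∀ x : ℕ → closure D,
      Tendsto (fun n => empiricalMeasure (fun i => (x i : EuclideanSpace ℝ (Fin d))) n) atTop
        (𝓝 (densityLaw hDo hDc.nonempty hDb hlam hpos).toFiniteMeasure) →
    ∀ (Ω : Type*) (_ : MeasurableSpace Ω) (P : Measure Ω) [IsProbabilityMeasure P]
      (ξ : ℕ → Ω → ℝ), iIndepFun ξ P → (∀ i, HasLaw (ξ i) (expMeasure 1) P) →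
      TendstoInDistribution
        (fun (n : ℕ) ω => LscFun.ofPoints n x (fun i => (n : ℝ) / totalRate D lam * ξ i ω))
        atTop W (fun _ => P) P' := by
  have hT := totalRate_pos hDo hDc.nonempty hDb hlam hpos
  have : CompactSpace (closure D) := isCompact_iff_compactSpace.1 hDb.isCompact_closure
  obtain ⟨μ, hμ⟩ := exists_map_val_eq_densityLaw hDo hDc.nonempty hDb hlam hpos
  let r : ℝ≥0 := ⟨totalRate D lam, hT.le⟩
  have hr : r ≠ 0 := fun h => hT.ne' (congrArg NNReal.toReal h)
  let ν : Measure (closure D) := r • (μ : Measure (closure D))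
  have hν : ∀ C, IsClosed C → ∫ y in C ∩ closure D, lam y = ν.real (Subtype.val ⁻¹' C) := by
    intro C hC
    have hμC := congrArg (fun m : FiniteMeasure (EuclideanSpace ℝ (Fin d)) =>
      (m : Measure (EuclideanSpace ℝ (Fin d))).real C) hμ
    simp only [FiniteMeasure.toMeasure_map] at hμC
    rw [map_measureReal_apply measurable_subtype_coe hC.measurableSet] at hμC
    rw [setIntegral_eq_totalRate_mul_densityLaw hDo hDc.nonempty hDb hlam hpos hC.measurableSet,
      measureReal_nnreal_smul_apply]
    exact congrArg (totalRate D lam * ·) hμC.symm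
  refine ⟨?_, ?_⟩
  · obtain ⟨κ, hκ, hvoid⟩ := LscFun.exists_hasVoidProb r (μ : Measure (closure D))
    exact ⟨LscFun (closure D), inferInstance, κ, id, hκ, hvoid.isExtremeValueProcess hν⟩
  · intro Ω' _ P' _ W hW x hx Ω _ P _ ξ hξ hlaw
    refine ⟨fun n => (LscFun.measurable_ofPoints n x).comp_aemeasurable
      (aemeasurable_pi_lambda _ fun i => (hlaw i).aemeasurable.const_mul _), hW.aemeasurable, ?_⟩
    have hemp : Tendsto (empiricalMeasure x) atTop (𝓝 μ.toFiniteMeasure) := by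
      -- Pushforward along a closed embedding is a topological embedding of spaces of finite
      -- measures, so weak convergence in the ambient space descends to `closure D`.
      rw [(FiniteMeasure.Topology.IsClosedEmbedding.isEmbedding_map_finiteMeasure Subtype.val
        isClosed_closure.isClosedEmbedding_subtypeVal).tendsto_nhds_iff, hμ]
      refine hx.congr fun n => ?_
      exact (map_empiricalMeasure measurable_subtype_coe x n).symm
    refine LscFun.tendsto_of_hasVoidProb (ν := ν)
      (νs := fun n => (r • empiricalMeasure x n : FiniteMeasure (closure D))) ?_
      (hW.hasVoidProb hν) fun A hA => ?_
    · filter_upwards [eventually_ne_atTop 0] with n hn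
      exact LscFun.hasVoidProb_map_ofPoints hr hn x hξ hlaw
    · have hA' : (μ : Measure (closure D)) (frontier A) = 0 := by
        simpa [ν, hr] using hA
      simp only [FiniteMeasure.toMeasure_smul, measureReal_nnreal_smul_apply, ν]
      exact (tendsto_empiricalMeasure_real hemp hA').const_mul _
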